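/- A permutation is a bijection $w$ of $\{1,2,3,\ldots\}$ with $w_i=i$ for all but finitely many $i$; permutations are composed as functions, $s_i$ is the transposition of $i$ and $i+1$, and $\ell(w)$ is the number of inversions of $w$. Let $R(w)$ be the set of reduced words of $w$, that is, of sequences $\rho=(\rho_1,\ldots,\rho_\ell)$ with $w=s_{\rho_1}s_{\rho_2}\cdots s_{\rho_\ell}$ and $\ell=\ell(w)$. The Schubert polynomial of $w$ is $$\mathfrak S_w=\sum_{\rho\in R(w)}\ \sum_{\alpha}\ x_{\alpha_1}\cdots x_{\alpha_\ell},$$ where $\alpha$ runs over the $\rho$-compatible sequences: sequences of positive integers $\alpha_1\le\cdots\le\alpha_\ell$ with $\alpha_j\le\rho_j$ for all $j$, and $\alpha_j<\alpha_{j+1}$ whenever $\rho_j<\rho_{j+1}$. The Stanley symmetric function of $w$ is $$S_w=\sum_{\rho\in R(w)}F_{\mathrm{Des}(\rho)}(x_1,x_2,\ldots),\qquad F_\alpha=\sum_{\mathrm{flat}(b)\text{ refines }\alpha}x^b,$$ where $\mathrm{Des}(\rho)$ is the list of the lengths of the maximal decreasing runs of $(\rho_1,\ldots,\rho_\ell)$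 from left to right, $b$ runs over the sequences $(b_1,b_2,\ldots)$ of non-negative integers with finitely many nonzero terms, and $\mathrm{flat}(b)$ is $b$ with its zero terms removed. For a polynomial or power series $f$ in $x_1,x_2,\ldots$, let $f(x_1,\ldots,x_k)$ be the result of setting $x_i=0$ for all $i>k$; $S_w(x_1,\ldots,x_k)$ is the Stanley symmetric polynomial of $w$ in $k$ variables. If $u_i=i$ for all $i>n$, let $u\times_n v$ be the permutation with $(u\times_n v)_i=u_i$ for $1\le i\le n$ and $(u\times_n v)_i=n+v_{i-n}$ for $i>n$. **Theorem.** Let $u$ and $v$ be permutations, and let $m$ be minimal such that $u_i=i$ for all $i>m$. Then for all integers $k,n$ with $m\le k\le n$, $$\mathfrak S_{u\times_n v}(x_1,\ldots,x_k)=\mathfrak S_u\cdot S_v(x_1,\ldots,x_k).$$ -/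

import Mathlib

/-!
Conventions. Everything is indexed from `0` : the position, value, letter or variable `i : ℕ` stands
for the usual position, value, letter or variable `i + 1`. Permutations are bijections of `ℕ`
that move only finitely many points; they are composed as functions, `(u * v) i = u (v i)`.
-/

namespace SchubertStanley

/-- The simple transposition interchanging `i` and `i + 1`. -/
def simpleTransposition (i : ℕ) : Equiv.Perm ℕ := Equiv.swap i (i + 1)

/-- The set of inversions of a permutation. -/
def inversions (w : Equiv.Perm ℕ) : Set (ℕ × ℕ) := {p | p.1 < p.2 ∧ w p.2 < w p.1}

/-- The length of a permutation: its number of inversions. -/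
noncomputable def permLength (w : Equiv.Perm ℕ) : ℕ := (inversions w).ncard

/-- The permutation `s_{ρ₁} ∘ s_{ρ₂} ∘ ⋯ ∘ s_{ρ_ℓ}`, for a word `ρ = [ρ₁, …, ρ_ℓ]`. -/
def wordProd (ρ : List ℕ) : Equiv.Perm ℕ := (ρ.map simpleTransposition).prod

/-- The set `R(w)` of reduced expressions of `w`. A reduced expression is often written from right
to left, `(ρ_ℓ, …, ρ₁)`, the simple transpositions acting in turn, from `s_{ρ₁}` to `s_{ρ_ℓ}`,
on the positions of the one-line notation of the identity; here it is the list `[ρ₁, …, ρ_ℓ]`. -/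
def reducedWords (w : Equiv.Perm ℕ) : Set (List ℕ) :=
  {ρ | wordProd ρ = w ∧ permLength w = ρ.length}

/-- The `ρ`-compatible sequences: weakly increasing, strictly increasing where `ρ` increases, and
bounded by `ρ` termwise. -/
def compatibleSeqs (ρ : List ℕ) : Set (Fin ρ.length → ℕ) :=
  {α | Monotone α ∧
    (∀ i j : Fin ρ.length, (j : ℕ) = (i : ℕ) + 1 → ρ.get i < ρ.get j → α i < α j) ∧
    ∀ j, α j ≤ ρ.get j}

/-- The Schubert polynomial of `w`, in the variables `X 0, X 1, …` (see `finite_reducedWords` and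
`finite_compatibleSeqs`: both sums are finite). -/
noncomputable def schubert (w : Equiv.Perm ℕ) : MvPolynomial ℕ ℤ :=
  ∑ᶠ ρ ∈ reducedWords w, ∑ᶠ α ∈ compatibleSeqs ρ, ∏ j, MvPolynomial.X (α j)

/-- `flat(b)`: the list of the nonzero parts of `b`, in order. -/
def flat (b : ℕ →₀ ℕ) : List ℕ := (b.support.sort (· ≤ ·)).map b

/-- `β` refines `α`: `β` can be cut into consecutive blocks whose sums are the parts of `α`. -/
def Refines (β α : List ℕ) : Prop :=
  ∃ L : List (List ℕ), L.flatten = β ∧ L.map List.sum = α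

open Classical in
/-- Gessel's fundamental quasisymmetric function
`F_α = ∑ x^b`, the sum over all `b` such that `flat(b)` refines `α`. -/
noncomputable def gesselF (α : List ℕ) : MvPowerSeries ℕ ℤ :=
  fun b => if Refines (flat b) α then 1 else 0

/-- The strong descent composition `Des(ρ)` : the lengths of the maximal decreasing runs of the list
`[ρ₁, …, ρ_ℓ]`, in order (these are the increasing runs of `(ρ_ℓ, …, ρ₁)`, from right to left). -/
def strongDes (ρ : List ℕ) : List ℕ :=
  (ρ.splitBy (fun a b => decide (b < a))).map List.length

/-- The Stanley symmetric function of `w`. -/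
noncomputable def stanley (w : Equiv.Perm ℕ) : MvPowerSeries ℕ ℤ :=
  ∑ᶠ ρ ∈ reducedWords w, gesselF (strongDes ρ)

open Classical in
/-- `f(x₁, …, x_k)`, the result of setting all variables but the first `k` equal to zero: the terms
in which another variable occurs are deleted. -/
noncomputable def truncateVars (k : ℕ) (f : MvPowerSeries ℕ ℤ) : MvPowerSeries ℕ ℤ :=
  fun b => if ∀ i ∈ b.support, i < k then MvPowerSeries.coeff b f else 0

/-- The permutation `u ×_n v`, where `u` fixes everything but the first `n` numbers:
`u` on the first `n` numbers, and `v` shifted by `n` on the others. -/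
def cross (n : ℕ) (u v : Equiv.Perm ℕ) (hu : ∀ i, n ≤ i → u i = i) : Equiv.Perm ℕ where
  toFun i := if i < n then u i else n + v (i - n)
  invFun i := if i < n then u.symm i else n + v.symm (i - n)
  left_inv i := by
    by_cases h : i < n
    · have h2 : u i < n := by
        by_contra hc
        have := u.injective (hu (u i) (by omega))
        omega
      simp [h, h2]
    · simp [h]
      omega
  right_inv i := by
    by_cases h : i < n
    · have h2 : u.symm i < n := by
        by_contra hc
        have := hu (u.symm i) (by omega)
        simp at this
        omega
      simp [h, h2]
    · simp [h]
      omega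

/-! Both sums in the definition of the Schubert polynomial are finite. -/

theorem finite_compatibleSeqs (ρ : List ℕ) : (compatibleSeqs ρ).Finite :=
  (Set.finite_Iic (fun j => ρ.get j)).subset fun _ h => h.2.2

theorem simpleTransposition_self (i c : ℕ) :
    simpleTransposition i (simpleTransposition i c) = c :=
  Equiv.swap_apply_self i (i + 1) c

theorem image_inversions (w : Equiv.Perm ℕ) (i : ℕ) :
    Prod.map (simpleTransposition i) (simpleTransposition i) '' (inversions w \ {(i, i + 1)})
      ⊆ inversions (w * simpleTransposition i) \ {(i, i + 1)} := by
  rintro _ ⟨⟨a, b⟩, ⟨⟨h1, h2⟩, h3⟩, rfl⟩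
  simp only [Set.mem_singleton_iff, Prod.mk.injEq] at h1 h2 h3
  refine ⟨⟨?_, ?_⟩, ?_⟩
  · simp only [simpleTransposition, Equiv.swap_apply_def, Prod.map]
    split_ifs <;> omega
  · simpa [simpleTransposition_self] using h2
  · simp only [simpleTransposition, Equiv.swap_apply_def, Prod.map, Set.mem_singleton_iff,
      Prod.mk.injEq]
    split_ifs <;> omega

theorem image_inversions_eq (w : Equiv.Perm ℕ) (i : ℕ) :
    Prod.map (simpleTransposition i) (simpleTransposition i) '' (inversions w \ {(i, i + 1)})
      = inversions (w * simpleTransposition i) \ {(i, i + 1)} := by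
  refine (image_inversions w i).antisymm fun p hp => ?_
  have h := image_inversions (w * simpleTransposition i) i ⟨p, hp, rfl⟩
  have hw : w * simpleTransposition i * simpleTransposition i = w := by
    ext c
    simp [simpleTransposition_self]
  rw [hw] at h
  exact ⟨_, h, by simp [Prod.map, simpleTransposition_self]⟩

theorem ncard_inversions_diff (w : Equiv.Perm ℕ) (i : ℕ) :
    (inversions (w * simpleTransposition i) \ {(i, i + 1)}).ncard
      = (inversions w \ {(i, i + 1)}).ncard := by
  rw [← image_inversions_eq]
  exact Set.ncard_image_of_injective _
    ((simpleTransposition i).injective.prodMap (simpleTransposition i).injective)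

theorem finite_inversions_mul (w : Equiv.Perm ℕ) (i : ℕ) (h : (inversions w).Finite) :
    (inversions (w * simpleTransposition i)).Finite := by
  have h1 : (inversions (w * simpleTransposition i) \ {(i, i + 1)}).Finite := by
    rw [← image_inversions_eq]
    exact (h.subset Set.sdiff_subset).image _
  exact Set.Finite.of_sdiff h1 (Set.finite_singleton _)

theorem wordProd_append_singleton (ρ : List ℕ) (i : ℕ) :
    wordProd (ρ ++ [i]) = wordProd ρ * simpleTransposition i := by
  simp [wordProd]

theorem finite_inversions_wordProd (ρ : List ℕ) : (inversions (wordProd ρ)).Finite := by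
  induction ρ using List.reverseRecOn with
  | nil =>
    convert Set.finite_empty
    ext p
    simp only [wordProd, inversions, List.map_nil, List.prod_nil, Equiv.Perm.one_apply,
      Set.mem_ofPred_eq, Set.mem_empty_iff_false, iff_false]
    omega
  | append_singleton ρ i ih =>
    rw [wordProd_append_singleton]
    exact finite_inversions_mul _ _ ih

/-- Multiplying by `s_i` at an ascent adds one inversion. -/
theorem permLength_mul_of_lt (w : Equiv.Perm ℕ) (i : ℕ) (hw : (inversions w).Finite)
    (h : w i < w (i + 1)) : permLength (w * simpleTransposition i) = permLength w + 1 := by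
  have h1 : (i, i + 1) ∈ inversions (w * simpleTransposition i) := by
    simp [inversions, simpleTransposition, h]
  have h2 : (i, i + 1) ∉ inversions w := by
    simp [inversions, h.le]
  have h3 := Set.ncard_sdiff_singleton_add_one h1 (finite_inversions_mul w i hw)
  rw [ncard_inversions_diff, Set.sdiff_singleton_eq_self h2] at h3
  exact h3.symm

theorem permLength_mul_of_gt (w : Equiv.Perm ℕ) (i : ℕ) (hw : (inversions w).Finite)
    (h : w (i + 1) < w i) : permLength (w * simpleTransposition i) + 1 = permLength w := by
  have h1 := permLength_mul_of_lt (w * simpleTransposition i) i (finite_inversions_mul w i hw)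
    (by simpa [simpleTransposition] using h)
  have hw : w * simpleTransposition i * simpleTransposition i = w := by
    ext c
    simp [simpleTransposition_self]
  rw [hw] at h1
  exact h1.symm

theorem permLength_wordProd_le (ρ : List ℕ) : permLength (wordProd ρ) ≤ ρ.length := by
  induction ρ using List.reverseRecOn with
  | nil =>
    have : inversions (wordProd []) = ∅ := by
      ext p
      simp only [wordProd, inversions, List.map_nil, List.prod_nil, Equiv.Perm.one_apply,
        Set.mem_ofPred_eq, Set.mem_empty_iff_false, iff_false]
      omega
    simp [permLength, this]
  | append_singleton ρ i ih =>
    have hf := finite_inversions_wordProd ρ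
    rw [wordProd_append_singleton, List.length_append, List.length_singleton]
    rcases lt_trichotomy (wordProd ρ i) (wordProd ρ (i + 1)) with h | h | h
    · rw [permLength_mul_of_lt _ _ hf h]
      omega
    · have := (wordProd ρ).injective h
      omega
    · have := permLength_mul_of_gt _ _ hf h
      omega

theorem finite_reducedWords (w : Equiv.Perm ℕ) : (reducedWords w).Finite := by
  obtain ⟨l, hl⟩ : ∃ l, permLength w = l := ⟨_, rfl⟩
  induction l generalizing w with
  | zero =>
    refine (Set.finite_singleton []).subset fun ρ hρ => ?_
    exact List.eq_nil_of_length_eq_zero (hρ.2.symm.trans hl)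
  | succ l ih =>
    have hfin : (inversions w).Finite := by
      refine Set.finite_of_ncard_ne_zero ?_
      change permLength w ≠ 0
      omega
    have hD : {i | (i, i + 1) ∈ inversions w}.Finite :=
      hfin.preimage (f := fun i => (i, i + 1)) fun a _ b _ h => (Prod.mk.inj h).1
    refine (hD.biUnion (t := fun i =>
      (fun ρ => ρ ++ [i]) '' reducedWords (w * simpleTransposition i)) fun i hi =>
        (ih _ ?_).image _).subset ?_
    · have := permLength_mul_of_gt w i hfin hi.2
      omega
    · intro ρ hρ
      rcases List.eq_nil_or_concat ρ with rfl | ⟨ρ', i, rfl⟩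
      · have := hρ.2
        simp [hl] at this
      · obtain ⟨h1, h2⟩ := hρ
        rw [List.concat_eq_append] at h1 h2
        rw [wordProd_append_singleton] at h1
        rw [List.length_append, List.length_singleton] at h2
        have h3 : wordProd ρ' = w * simpleTransposition i := by
          rw [← h1]
          ext c
          simp [simpleTransposition_self]
        have h4 := permLength_wordProd_le ρ'
        rw [h3] at h4
        have h5 : w (i + 1) < w i := by
          rcases lt_trichotomy (w i) (w (i + 1)) with h | h | h
          · have := permLength_mul_of_lt w i hfin h
            omega
          · have := w.injective h
            omega
          · exact h
        have h6 := permLength_mul_of_gt w i hfin h5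
        exact Set.mem_biUnion (x := i) ⟨i.lt_succ_self, h5⟩
          ⟨ρ', ⟨h3, by omega⟩, List.concat_eq_append.symm⟩

end SchubertStanley

namespace SchubertStanley

/-! ### Reduced words -/

theorem wordProd_cons (r : ℕ) (ρ : List ℕ) :
    wordProd (r :: ρ) = simpleTransposition r * wordProd ρ := by
  simp [wordProd]

theorem wordProd_append (ρ σ : List ℕ) : wordProd (ρ ++ σ) = wordProd ρ * wordProd σ := by
  simp [wordProd]

/-- The last letter of a reduced word is an ascent of the product of the other letters. -/
theorem reduced_of_append_singleton {ρ : List ℕ} {i : ℕ}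
    (h : permLength (wordProd (ρ ++ [i])) = (ρ ++ [i]).length) :
    permLength (wordProd ρ) = ρ.length ∧ wordProd ρ i < wordProd ρ (i + 1) := by
  have hf := finite_inversions_wordProd ρ
  have hle := permLength_wordProd_le ρ
  rw [wordProd_append_singleton, List.length_append, List.length_singleton] at h
  rcases lt_trichotomy (wordProd ρ i) (wordProd ρ (i + 1)) with h1 | h1 | h1
  · have := permLength_mul_of_lt _ _ hf h1
    exact ⟨by omega, h1⟩
  · have := (wordProd ρ).injective h1
    omega
  · have := permLength_mul_of_gt _ _ hf h1
    omega

/-- The reduced words of a permutation of the first `n` numbers and of the others do not involve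
the transposition of the `n`-th number and the next one. -/
theorem add_one_ne_of_mem_reduced {n : ℕ} {ρ : List ℕ}
    (hρ : permLength (wordProd ρ) = ρ.length) (h : ∀ i, wordProd ρ i < n ↔ i < n) :
    ∀ r ∈ ρ, r + 1 ≠ n := by
  induction ρ using List.reverseRecOn with
  | nil => simp
  | append_singleton ρ r ih =>
    obtain ⟨h1, h2⟩ := reduced_of_append_singleton hρ
    have happ : ∀ i, wordProd (ρ ++ [r]) i = wordProd ρ (simpleTransposition r i) := fun i => by
      rw [wordProd_append_singleton, Equiv.Perm.mul_apply]
    have hr : r + 1 ≠ n := by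
      intro hrn
      have h3 := h r
      have h4 := h (r + 1)
      rw [happ] at h3 h4
      simp only [simpleTransposition, Equiv.swap_apply_left, Equiv.swap_apply_right] at h3 h4
      omega
    intro s hs
    rcases List.mem_append.1 hs with hs | hs
    · refine ih h1 (fun i => ?_) s hs
      have h3 := h (simpleTransposition r i)
      rw [happ, simpleTransposition_self] at h3
      rw [h3]
      simp only [simpleTransposition, Equiv.swap_apply_def]
      split_ifs <;> omega
    · rw [List.mem_singleton.1 hs]
      exact hr

theorem isChain_ne_of_reduced {ρ : List ℕ} (hρ : permLength (wordProd ρ) = ρ.length) :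
    ρ.IsChain (· ≠ ·) := by
  rw [List.isChain_iff_forall_rel_of_append_cons_cons]
  rintro a b l l' rfl rfl
  have h : wordProd (l ++ a :: a :: l') = wordProd (l ++ l') := by
    rw [wordProd_append, wordProd_cons, wordProd_cons, wordProd_append]
    congr 1
    ext c
    simp [simpleTransposition_self]
  have h1 := permLength_wordProd_le (l ++ l')
  rw [← h, hρ] at h1
  simp at h1

theorem wordProd_apply_of_le {n : ℕ} {ρ : List ℕ} (h : ∀ r ∈ ρ, r + 1 < n) {i : ℕ} (hi : n ≤ i) :
    wordProd ρ i = i := by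
  induction ρ with
  | nil => simp [wordProd]
  | cons r ρ ih =>
    rw [wordProd_cons, Equiv.Perm.mul_apply, ih fun s hs => h s (List.mem_cons_of_mem _ hs)]
    have := h r List.mem_cons_self
    exact Equiv.swap_apply_of_ne_of_ne (by omega) (by omega)

theorem wordProd_map_add_apply (n : ℕ) (ρ : List ℕ) (i : ℕ) :
    wordProd (ρ.map (n + ·)) i = if i < n then i else n + wordProd ρ (i - n) := by
  induction ρ with
  | nil =>
    simp only [List.map_nil, wordProd, List.prod_nil, Equiv.Perm.one_apply]
    split_ifs <;> omega
  | cons r ρ ih =>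
    rw [List.map_cons, wordProd_cons, wordProd_cons, Equiv.Perm.mul_apply, Equiv.Perm.mul_apply, ih]
    simp only [simpleTransposition, Equiv.swap_apply_def]
    split_ifs <;> omega

theorem commute_simpleTransposition {r s : ℕ} (h : r + 1 < s) :
    Commute (simpleTransposition r) (simpleTransposition s) := by
  ext i
  simp only [simpleTransposition, Equiv.Perm.mul_apply, Equiv.swap_apply_def]
  split_ifs <;> omega

theorem wordProd_eq_mul_filter {n : ℕ} {ρ : List ℕ} (h : ∀ r ∈ ρ, r + 1 ≠ n) :
    wordProd ρ = wordProd (ρ.filter (· < n)) * wordProd (ρ.filter (n ≤ ·)) := by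
  induction ρ with
  | nil => simp [wordProd]
  | cons r ρ ih =>
    rw [wordProd_cons, ih fun s hs => h s (List.mem_cons_of_mem _ hs)]
    rcases lt_or_ge r n with hr | hr
    · rw [List.filter_cons_of_pos (by simpa using hr), List.filter_cons_of_neg (by simpa using hr),
        wordProd_cons, mul_assoc]
    · rw [List.filter_cons_of_neg (by simpa using hr), List.filter_cons_of_pos (by simpa using hr),
        wordProd_cons, ← mul_assoc, ← mul_assoc]
      congr 1
      refine Commute.list_prod_right _ _ ?_
      simp only [List.mem_map, List.mem_filter, decide_eq_true_eq]
      rintro _ ⟨s, ⟨hs, hsn⟩, rfl⟩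
      have := h s (List.mem_cons_of_mem _ hs)
      exact (commute_simpleTransposition (by omega)).symm

theorem apply_lt_iff {n : ℕ} {u : Equiv.Perm ℕ} (hu : ∀ i, n ≤ i → u i = i) (i : ℕ) :
    u i < n ↔ i < n := by
  rcases lt_or_ge i n with h | h
  · refine ⟨fun _ => h, fun _ => ?_⟩
    by_contra hc
    have := u.injective (hu (u i) (by omega))
    omega
  · rw [hu i h]

theorem cross_lt_iff {n : ℕ} {u v : Equiv.Perm ℕ} (hu : ∀ i, n ≤ i → u i = i) (i : ℕ) :
    cross n u v hu i < n ↔ i < n := by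
  simp only [cross, Equiv.coe_fn_mk]
  split_ifs with hi
  · exact apply_lt_iff hu i
  · simp [hi]

theorem cross_inj {n : ℕ} {u v u' v' : Equiv.Perm ℕ} {hu : ∀ i, n ≤ i → u i = i}
    {hu' : ∀ i, n ≤ i → u' i = i} (h : cross n u v hu = cross n u' v' hu') : u = u' ∧ v = v' := by
  have h1 : ∀ i, cross n u v hu i = cross n u' v' hu' i := fun i => by rw [h]
  constructor <;> ext i
  · rcases lt_or_ge i n with hi | hi
    · simpa [cross, hi] using h1 i
    · rw [hu i hi, hu' i hi]
  · simpa [cross] using h1 (n + i)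

theorem wordProd_mul_wordProd_map_add {n : ℕ} {ρ : List ℕ} (h : ∀ r ∈ ρ, r + 1 < n) (σ : List ℕ) :
    wordProd ρ * wordProd (σ.map (n + ·)) =
      cross n (wordProd ρ) (wordProd σ) fun _ hi => wordProd_apply_of_le h hi := by
  ext i
  rw [Equiv.Perm.mul_apply, wordProd_map_add_apply]
  simp only [cross, Equiv.coe_fn_mk]
  split_ifs with hi
  · rfl
  · exact wordProd_apply_of_le h (by omega)

theorem inversions_cross {n : ℕ} {u v : Equiv.Perm ℕ} (hu : ∀ i, n ≤ i → u i = i) :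
    inversions (cross n u v hu) =
      inversions u ∪ Prod.map (n + ·) (n + ·) '' inversions v := by
  have hlt : ∀ i, i < n → u i < n := fun i => (apply_lt_iff hu i).2
  ext ⟨i, j⟩
  simp only [inversions, cross, Equiv.coe_fn_mk, Set.mem_union, Set.mem_image, Set.mem_ofPred_eq,
    Prod.exists, Prod.map_apply, Prod.mk.injEq]
  constructor
  · rintro ⟨h1, h2⟩
    by_cases hj : j < n
    · rw [if_pos hj, if_pos (h1.trans hj)] at h2
      exact Or.inl ⟨h1, h2⟩
    · by_cases hi : i < n
      · have := hlt i hi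
        rw [if_neg hj, if_pos hi] at h2
        omega
      · rw [if_neg hj, if_neg hi] at h2
        exact Or.inr ⟨i - n, j - n, ⟨by omega, by omega⟩, by omega, by omega⟩
  · rintro (⟨h1, h2⟩ | ⟨i, j, ⟨h1, h2⟩, rfl, rfl⟩)
    · by_cases hj : j < n
      · rw [if_pos hj, if_pos (h1.trans hj)]
        exact ⟨h1, h2⟩
      · rw [hu j (by omega)] at h2
        by_cases hi : i < n
        · have := hlt i hi
          omega
        · rw [hu i (by omega)] at h2
          omega
    · simp [h1, h2]

theorem permLength_cross {n : ℕ} {u v : Equiv.Perm ℕ} (hu : ∀ i, n ≤ i → u i = i)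
    (hfu : (inversions u).Finite) (hfv : (inversions v).Finite) :
    permLength (cross n u v hu) = permLength u + permLength v := by
  have hinj : Function.Injective (Prod.map (n + ·) (n + ·) : ℕ × ℕ → ℕ × ℕ) :=
    (add_right_injective n).prodMap (add_right_injective n)
  rw [permLength, inversions_cross, Set.ncard_union_eq ?_ hfu (hfv.image _),
    Set.ncard_image_of_injective _ hinj, permLength, permLength]
  rw [Set.disjoint_left]
  rintro _ h ⟨⟨i, j⟩, -, rfl⟩
  obtain ⟨h1, h2⟩ := h
  simp only [Prod.map_apply] at h1 h2
  rw [hu _ (by omega), hu _ (by omega)] at h2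
  omega

/-- The reduced words of `u ×_n v` are the shuffles of those of `u` and of the shifts by `n` of
those of `v`. -/
theorem mem_reducedWords_cross_iff {n : ℕ} {u v : Equiv.Perm ℕ} (hu : ∀ i, n ≤ i → u i = i)
    {ρ σ τ : List ℕ} (hρ : τ.filter (· < n) = ρ) (hσ : τ.filter (n ≤ ·) = σ.map (n + ·)) :
    τ ∈ reducedWords (cross n u v hu) ↔ ρ ∈ reducedWords u ∧ σ ∈ reducedWords v := by
  have hmem : ∀ r ∈ τ, r ∈ ρ ∨ n ≤ r := fun r hr => by
    rcases lt_or_ge r n with h | h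
    · left
      rw [← hρ]
      simp [hr, h]
    · exact Or.inr h
  have hlt : ∀ r ∈ ρ, r ∈ τ ∧ r < n := fun r hr => by
    rw [← hρ] at hr
    simpa using hr
  have hlen : τ.length = ρ.length + σ.length := by
    rw [← List.length_map (as := σ) (fun r => n + r), ← hσ, ← hρ]
    have h : (fun r => decide (n ≤ r)) = fun r => !decide (r < n) :=
      funext fun r => by rw [← decide_not, decide_eq_decide, not_lt]
    rw [h]
    exact List.length_eq_length_filter_add _
  have key (h : ∀ r ∈ ρ, r + 1 < n) : wordProd τ =
      cross n (wordProd ρ) (wordProd σ) fun _ hi => wordProd_apply_of_le h hi := by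
    rw [← wordProd_mul_wordProd_map_add h, ← hρ, ← hσ]
    refine wordProd_eq_mul_filter fun r hr => ?_
    rcases hmem r hr with h1 | h1
    · exact (h r h1).ne
    · omega
  constructor
  · rintro ⟨h1, h2⟩
    have hne := add_one_ne_of_mem_reduced (n := n) (ρ := τ) (by rw [h1, h2])
      (by rw [h1]; exact cross_lt_iff hu)
    have hlt' : ∀ r ∈ ρ, r + 1 < n := fun r hr => by
      have h3 := hlt r hr
      have := hne r h3.1
      omega
    have h3 := key hlt'
    rw [h1] at h3
    obtain ⟨rfl, rfl⟩ := cross_inj h3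
    rw [permLength_cross _ (finite_inversions_wordProd ρ) (finite_inversions_wordProd σ)] at h2
    have := permLength_wordProd_le ρ
    have := permLength_wordProd_le σ
    exact ⟨⟨rfl, by omega⟩, rfl, by omega⟩
  · rintro ⟨⟨rfl, h1⟩, rfl, h2⟩
    have hlt' : ∀ r ∈ ρ, r + 1 < n := fun r hr => by
      have h3 := add_one_ne_of_mem_reduced h1 (apply_lt_iff hu) r hr
      have := (hlt r hr).2
      omega
    refine ⟨key hlt', ?_⟩
    rw [permLength_cross _ (finite_inversions_wordProd ρ) (finite_inversions_wordProd σ)]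
    omega

/-! ### Refinements of the lengths of runs -/

section Runs

variable {α : Type*} {r : α → α → Bool}

theorem exists_cut_of_map_sum_eq {G : List (List α)}
    (hG : ∀ g ∈ G, g.IsChain fun x y => r x y) {L : List (List ℕ)}
    (hL : L.map List.sum = G.map List.length) :
    ∃ M : List (List α), M.flatten = G.flatten ∧ M.map List.length = L.flatten ∧
      ∀ m ∈ M, m.IsChain fun x y => r x y := by
  induction G generalizing L with
  | nil =>
    obtain rfl : L = [] := by simpa using hL
    exact ⟨[], rfl, rfl, by simp⟩
  | cons g G ih =>
    cases L with
    | nil => simp at hL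
    | cons l L =>
      simp only [List.map_cons, List.cons.injEq] at hL
      obtain ⟨M, h1, h2, h3⟩ := ih (fun g hg => hG g (List.mem_cons_of_mem _ hg)) hL.2
      have hfl : (l.splitLengths g).flatten = g := List.flatten_splitLengths _ _ hL.1.ge
      refine ⟨l.splitLengths g ++ M, by simp [h1, hfl], ?_, fun m hm => ?_⟩
      · simp [h2, List.map_splitLengths_length _ _ hL.1.le]
      · rcases List.mem_append.1 hm with hm | hm
        · refine (hG g List.mem_cons_self).infix ?_
          rw [← hfl]
          obtain ⟨s, t, hst⟩ := List.append_of_mem hm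
          exact ⟨s.flatten, t.flatten, by rw [hst]; simp⟩
        · exact h3 m hm

theorem exists_grouping_splitBy {M : List (List α)} (hM : [] ∉ M)
    (hc : ∀ m ∈ M, m.IsChain fun x y => r x y) :
    ∃ N : List (List (List α)), N.flatten = M ∧
      N.map List.flatten = M.flatten.splitBy r := by
  induction M with
  | nil => exact ⟨[], by simp⟩
  | cons m M ih =>
    rw [List.mem_cons, not_or] at hM
    have hm : m ≠ [] := fun h => hM.1 h.symm
    have hmc := hc m List.mem_cons_self
    obtain ⟨N, hN, hN'⟩ := ih hM.2 fun m hm => hc m (List.mem_cons_of_mem _ hm)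
    by_cases hr : ∀ x ∈ m.getLast?, ∀ y ∈ M.flatten.head?, r x y = false
    · refine ⟨[m] :: N, by simp [hN], ?_⟩
      rw [List.flatten_cons, List.splitBy_append hr, List.splitBy_of_isChain hm hmc, ← hN']
      simp
    · push Not at hr
      obtain ⟨x, hx, y, hy, hxy⟩ := hr
      cases N with
      | nil =>
        have : M = [] := by simpa using hN.symm
        simp [this] at hy
      | cons n N =>
        refine ⟨(m :: n) :: N, by simp [← hN], ?_⟩
        rw [List.map_cons, eq_comm, List.splitBy_eq_iff] at hN'
        obtain ⟨h1, h2, h3, h4⟩ := hN'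
        rw [List.mem_cons, not_or] at h2
        have hn : n.flatten ≠ [] := fun h => h2.1 h.symm
        rw [eq_comm, List.splitBy_eq_iff]
        refine ⟨by simp [h1], by simp_all, fun l hl => ?_, ?_⟩
        · rw [List.map_cons, List.mem_cons] at hl
          rcases hl with rfl | hl
          · rw [List.flatten_cons, List.isChain_append]
            refine ⟨hmc, h3 _ List.mem_cons_self, fun x' hx' y' hy' => ?_⟩
            obtain rfl : x' = x := Option.mem_unique hx' hx
            rw [h1, List.flatten_cons, List.head?_append_of_ne_nil _ hn] at hy
            obtain rfl : y' = y := Option.mem_unique hy' hy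
            simpa using hxy
          · exact h3 _ (List.mem_cons_of_mem _ hl)
        · rw [List.map_cons, List.isChain_cons]
          rw [List.isChain_cons] at h4
          refine ⟨fun l hl => ?_, h4.2⟩
          obtain ⟨h5, h6, h7⟩ := h4.1 l hl
          refine ⟨by simp [hm], h6, ?_⟩
          simp only [List.flatten_cons]
          rw [List.getLast_append_of_ne_nil _ hn]
          exact h7

/-- A list of positive integers refines the lengths of the runs of `ρ` if and only if `ρ` can be cut
into monotone pieces of these lengths. -/
theorem refines_splitBy_iff {ρ : List α} {β : List ℕ} (hβ : 0 ∉ β) :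
    Refines β ((ρ.splitBy r).map List.length) ↔
      ∃ M : List (List α), M.flatten = ρ ∧ M.map List.length = β ∧
        ∀ m ∈ M, m.IsChain fun x y => r x y := by
  constructor
  · rintro ⟨L, rfl, hL⟩
    obtain ⟨M, h1, h2, h3⟩ :=
      exists_cut_of_map_sum_eq (fun g hg => List.isChain_of_mem_splitBy hg) hL
    exact ⟨M, by rw [h1, List.flatten_splitBy], h2, h3⟩
  · rintro ⟨M, rfl, rfl, hM⟩
    obtain ⟨N, h1, h2⟩ := exists_grouping_splitBy (fun h => hβ (by simpa using h)) hM
    refine ⟨N.map (List.map List.length), ?_, ?_⟩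
    · rw [← h1, List.map_flatten]
    · rw [← h2]
      simp [List.length_flatten, Function.comp_def]

end Runs

/-! ### Sets of cells -/

/-- A cell, with a row and a letter. Cells are ordered by increasing rows, and in each row by
decreasing letters. -/
abbrev Cell := ℕ ×ₗ ℕᵒᵈ

namespace Cell

/-- The row of a cell. -/
def row (p : Cell) : ℕ := (ofLex p).1

/-- The letter of a cell. -/
def letter (p : Cell) : ℕ := OrderDual.ofDual (ofLex p).2

/-- The cell with given row and letter. -/
def mk (a r : ℕ) : Cell := toLex (a, OrderDual.toDual r)

@[simp] theorem row_mk (a r : ℕ) : (mk a r).row = a := rfl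

@[simp] theorem letter_mk (a r : ℕ) : (mk a r).letter = r := rfl

@[simp] theorem mk_row_letter (p : Cell) : mk p.row p.letter = p := rfl

theorem ext {p q : Cell} (h1 : p.row = q.row) (h2 : p.letter = q.letter) : p = q := by
  rw [← mk_row_letter p, h1, h2, mk_row_letter]

theorem lt_iff {p q : Cell} :
    p < q ↔ p.row < q.row ∨ p.row = q.row ∧ q.letter < p.letter :=
  Prod.Lex.lt_iff

theorem row_le_row {p q : Cell} (h : p ≤ q) : p.row ≤ q.row := by
  rcases h.eq_or_lt with rfl | h
  · exact le_rfl
  · rcases lt_iff.1 h with h | h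
    · exact h.le
    · exact h.1.le

end Cell

/-- The letters of a set of cells, in order. -/
def cellWord (P : Finset Cell) : List ℕ := P.sort.map Cell.letter

/-- The number of cells in each row. -/
noncomputable def cellWeight (P : Finset Cell) : ℕ →₀ ℕ := ∑ p ∈ P, Finsupp.single p.row 1

theorem cellWeight_apply (P : Finset Cell) (i : ℕ) :
    cellWeight P i = (P.filter (·.row = i)).card := by
  rw [cellWeight, Finsupp.finsetSum_apply, Finset.card_filter]
  exact Finset.sum_congr rfl fun p _ => by rw [Finsupp.single_apply]

theorem sort_toFinset_of_pairwise_lt {l : List Cell} (h : l.Pairwise (· < ·)) :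
    l.toFinset.sort = l :=
  (List.toFinset_sort _ (h.imp ne_of_lt)).2 (h.imp le_of_lt)

theorem cellWord_toFinset {l : List Cell} (h : l.Pairwise (· < ·)) :
    cellWord l.toFinset = l.map Cell.letter := by
  rw [cellWord, sort_toFinset_of_pairwise_lt h]

theorem cellWeight_toFinset {l : List Cell} (h : l.Pairwise (· < ·)) :
    cellWeight l.toFinset = (l.map fun p => Finsupp.single p.row 1).sum := by
  rw [cellWeight, List.sum_toFinset _ (h.imp ne_of_lt)]

theorem pairwise_lt_sort (P : Finset Cell) : P.sort.Pairwise (· < ·) :=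
  (Finset.sortedLT_sort P).pairwise

theorem length_cellWord (P : Finset Cell) : (cellWord P).length = P.card := by
  simp [cellWord]

theorem mem_cellWord {P : Finset Cell} {r : ℕ} : r ∈ cellWord P ↔ ∃ p ∈ P, p.letter = r := by
  simp [cellWord]

/-- A set of cells is determined by its word and its weight. -/
theorem cellWord_cellWeight_inj {P Q : Finset Cell} (h1 : cellWord P = cellWord Q)
    (h2 : cellWeight P = cellWeight Q) : P = Q := by
  have hrow : P.sort.map Cell.row = Q.sort.map Cell.row := by
    refine List.Perm.eq_of_pairwise' (r := (· ≤ ·)) ?_ ?_ ?_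
    · exact List.pairwise_map.2 ((Finset.pairwise_sort P _).imp Cell.row_le_row)
    · exact List.pairwise_map.2 ((Finset.pairwise_sort Q _).imp Cell.row_le_row)
    · rw [← Multiset.coe_eq_coe, ← Multiset.map_coe, ← Multiset.map_coe, Finset.sort_eq,
        Finset.sort_eq]
      ext i
      have h := DFunLike.congr_fun h2 i
      rw [cellWeight_apply, cellWeight_apply] at h
      rw [Multiset.count_map, Multiset.count_map]
      simpa [Finset.card_def, eq_comm] using h
  have hmap : ∀ P : Finset Cell,
      P.sort = List.zipWith Cell.mk (P.sort.map Cell.row) (P.sort.map Cell.letter) := fun P => by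
    rw [List.zipWith_map]
    simp
  rw [← Finset.sort_toFinset P (· ≤ ·), ← Finset.sort_toFinset Q (· ≤ ·), hmap P, hmap Q, hrow]
  rw [cellWord, cellWord] at h1
  rw [h1]

theorem exists_cells_of_cut {s : List ℕ} (hs : s.Pairwise (· < ·)) {b : ℕ → ℕ} {M : List (List ℕ)}
    (hM : M.map List.length = s.map b) (hc : ∀ m ∈ M, m.Pairwise (· > ·)) :
    ∃ l : List Cell, l.Pairwise (· < ·) ∧ l.map Cell.letter = M.flatten ∧
      (l.map fun p => Finsupp.single p.row 1).sum = (s.map fun i => Finsupp.single i (b i)).sum ∧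
      ∀ p ∈ l, p.row ∈ s := by
  induction s generalizing M with
  | nil =>
    obtain rfl : M = [] := by simpa using hM
    exact ⟨[], by simp⟩
  | cons i s ih =>
    cases M with
    | nil => simp at hM
    | cons m M =>
      simp only [List.map_cons, List.cons.injEq] at hM
      rw [List.pairwise_cons] at hs
      obtain ⟨l, h1, h2, h3, h4⟩ := ih hs.2 hM.2 fun m hm => hc m (List.mem_cons_of_mem _ hm)
      refine ⟨m.map (Cell.mk i) ++ l, ?_, ?_, ?_, ?_⟩
      · rw [List.pairwise_append]
        refine ⟨?_, h1, ?_⟩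
        · refine List.pairwise_map.2 ((hc m List.mem_cons_self).imp fun {a c} h => ?_)
          exact Cell.lt_iff.2 (Or.inr ⟨rfl, h⟩)
        · intro p hp q hq
          obtain ⟨r, -, rfl⟩ := List.mem_map.1 hp
          exact Cell.lt_iff.2 (Or.inl (hs.1 _ (h4 q hq)))
      · simp [h2, Function.comp_def]
      · simp [h3, ← hM.1, Function.comp_def]
      · intro p hp
        rcases List.mem_append.1 hp with hp | hp
        · obtain ⟨r, -, rfl⟩ := List.mem_map.1 hp
          simp
        · exact List.mem_cons_of_mem _ (h4 p hp)

theorem sort_eq_flatMap_filter {P : Finset Cell} {s : Finset ℕ} (hs : ∀ p ∈ P, p.row ∈ s) :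
    P.sort = s.sort.flatMap fun i => (P.filter (·.row = i)).sort := by
  have h : (s.sort.flatMap fun i => (P.filter (·.row = i)).sort).Pairwise (· < ·) := by
    rw [List.pairwise_flatMap]
    refine ⟨fun i _ => pairwise_lt_sort _, (Finset.sortedLT_sort s).pairwise.imp ?_⟩
    intro i j hij p hp q hq
    simp only [Finset.mem_sort, Finset.mem_filter] at hp hq
    exact Cell.lt_iff.2 (Or.inl (by rw [hp.2, hq.2]; exact hij))
  rw [← sort_toFinset_of_pairwise_lt h]
  congr 1
  ext p
  simp only [List.mem_toFinset, List.mem_flatMap, Finset.mem_sort, Finset.mem_filter]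
  exact ⟨fun hp => ⟨_, hs p hp, hp, rfl⟩, fun ⟨_, _, hp, _⟩ => hp⟩

theorem exists_cells_iff_refines {ρ : List ℕ} {b : ℕ →₀ ℕ} :
    (∃ P, cellWord P = ρ ∧ cellWeight P = b) ↔ Refines (flat b) (strongDes ρ) := by
  have h0 : 0 ∉ flat b := by simp [flat]
  rw [strongDes, refines_splitBy_iff h0]
  simp only [decide_eq_true_eq]
  constructor
  · rintro ⟨P, rfl, rfl⟩
    have hs : ∀ p ∈ P, p.row ∈ (cellWeight P).support := fun p hp => by
      rw [Finsupp.mem_support_iff, cellWeight_apply]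
      exact Finset.card_ne_zero_of_mem (Finset.mem_filter.2 ⟨hp, rfl⟩)
    refine ⟨(cellWeight P).support.sort.map fun i => cellWord (P.filter (·.row = i)), ?_, ?_, ?_⟩
    · rw [cellWord, sort_eq_flatMap_filter hs, List.map_flatMap, List.flatMap_def]
      rfl
    · rw [flat, List.map_map]
      refine List.map_congr_left fun i _ => ?_
      rw [Function.comp_apply, length_cellWord, cellWeight_apply]
    · intro m hm
      obtain ⟨i, -, rfl⟩ := List.mem_map.1 hm
      refine List.Pairwise.isChain (List.pairwise_map.2 ?_)
      refine (pairwise_lt_sort (P.filter (·.row = i))).imp_of_mem fun {p q} hp hq h => ?_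
      simp only [Finset.mem_sort, Finset.mem_filter] at hp hq
      have := Cell.lt_iff.1 h
      omega
  · rintro ⟨M, rfl, h1, h2⟩
    obtain ⟨l, h3, h4, h5, -⟩ := exists_cells_of_cut (Finset.sortedLT_sort b.support).pairwise h1
      fun m hm => (h2 m hm).pairwise
    refine ⟨l.toFinset, by rw [cellWord_toFinset h3, h4], ?_⟩
    rw [cellWeight_toFinset h3, h5, ← List.sum_toFinset _ (Finset.sort_nodup _ _),
      Finset.sort_toFinset]
    exact b.sum_single

/-! ### The coefficients as numbers of sets of cells -/

theorem ncard_eq_sum_ncard_fiber {α β : Type*} {A : Set α} (hA : A.Finite) {f : α → β}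
    {t : Finset β} (h : ∀ x ∈ A, f x ∈ t) : A.ncard = ∑ y ∈ t, {x ∈ A | f x = y}.ncard := by
  classical
  rw [Set.ncard_eq_toFinset_card A hA,
    Finset.card_eq_sum_card_fiberwise (f := f) (t := t) fun x hx => h x (by simpa using hx)]
  refine Finset.sum_congr rfl fun y _ => ?_
  rw [← Set.ncard_coe_finset]
  congr 1
  ext x
  simp

/-- The sets of cells whose word is a reduced word of `w`, with given weight. -/
def reducedCells (w : Equiv.Perm ℕ) (b : ℕ →₀ ℕ) : Set (Finset Cell) :=
  {P | cellWord P ∈ reducedWords w ∧ cellWeight P = b}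

/-- The sets of cells of `reducedCells w b` such that the row of each cell is at most its
letter. -/
def boundedCells (w : Equiv.Perm ℕ) (b : ℕ →₀ ℕ) : Set (Finset Cell) :=
  {P ∈ reducedCells w b | ∀ p ∈ P, p.row ≤ p.letter}

theorem injOn_cellWord (w : Equiv.Perm ℕ) (b : ℕ →₀ ℕ) :
    Set.InjOn cellWord (reducedCells w b) :=
  fun _ hP _ hQ h => cellWord_cellWeight_inj h (hP.2.trans hQ.2.symm)

theorem finite_reducedCells (w : Equiv.Perm ℕ) (b : ℕ →₀ ℕ) : (reducedCells w b).Finite :=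
  Set.Finite.of_finite_image ((finite_reducedWords w).subset (Set.image_subset_iff.2 fun _ h => h.1))
    (injOn_cellWord w b)

theorem finite_boundedCells (w : Equiv.Perm ℕ) (b : ℕ →₀ ℕ) : (boundedCells w b).Finite :=
  (finite_reducedCells w b).subset (Set.sep_subset _ _)

theorem coeff_stanley (w : Equiv.Perm ℕ) (b : ℕ →₀ ℕ) :
    MvPowerSeries.coeff b (stanley w) = ((reducedCells w b).ncard : ℤ) := by
  rw [stanley, finsum_mem_eq_finite_toFinset_sum _ (finite_reducedWords w), map_sum,
    ncard_eq_sum_ncard_fiber (finite_reducedCells w b) (f := cellWord)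
      (t := (finite_reducedWords w).toFinset) fun P hP => by simpa using hP.1, Nat.cast_sum]
  refine Finset.sum_congr rfl fun ρ hρ => ?_
  rw [Set.Finite.mem_toFinset] at hρ
  classical
  change (if Refines (flat b) (strongDes ρ) then (1 : ℤ) else 0) = _
  split_ifs with h
  · obtain ⟨P, hP, hb⟩ := exists_cells_iff_refines.2 h
    have : {Q ∈ reducedCells w b | cellWord Q = ρ} = {P} := by
      ext Q
      constructor
      · rintro ⟨h1, h2⟩
        exact cellWord_cellWeight_inj (h2.trans hP.symm) (h1.2.trans hb.symm)
      · rintro rfl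
        exact ⟨⟨by rwa [hP], hb⟩, hP⟩
    rw [this, Set.ncard_singleton, Nat.cast_one]
  · have : {Q ∈ reducedCells w b | cellWord Q = ρ} = ∅ := by
      ext Q
      simp only [Set.mem_empty_iff_false, iff_false]
      rintro ⟨h1, h2⟩
      exact h (exists_cells_iff_refines.1 ⟨Q, h2, h1.2⟩)
    rw [this, Set.ncard_empty, Nat.cast_zero]

/-- The list of cells with given letters, in given rows. -/
def cellList (ρ : List ℕ) (α : Fin ρ.length → ℕ) : List Cell :=
  List.ofFn fun j => Cell.mk (α j) (ρ.get j)

theorem map_letter_cellList (ρ : List ℕ) (α : Fin ρ.length → ℕ) :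
    (cellList ρ α).map Cell.letter = ρ := by
  simp [cellList, List.map_ofFn, Function.comp_def]

theorem pairwise_cellList {ρ : List ℕ} (hρ : ρ.IsChain (· ≠ ·)) {α : Fin ρ.length → ℕ}
    (hα : α ∈ compatibleSeqs ρ) : (cellList ρ α).Pairwise (· < ·) := by
  rw [← List.isChain_iff_pairwise, List.isChain_iff_getElem]
  intro i hi
  simp only [cellList, List.length_ofFn] at hi
  simp only [cellList, List.getElem_ofFn]
  rw [Cell.lt_iff]
  simp only [Cell.row_mk, Cell.letter_mk]
  rw [List.isChain_iff_getElem] at hρ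
  have h1 := hρ i hi
  have h2 : α ⟨i, by omega⟩ ≤ α ⟨i + 1, hi⟩ := hα.1 (by simp)
  have h3 := hα.2.1 ⟨i, by omega⟩ ⟨i + 1, hi⟩ rfl
  simp only [List.get_eq_getElem] at h3 ⊢
  omega

theorem ncard_compatibleSeqs {ρ : List ℕ} (hρ : ρ.IsChain (· ≠ ·)) (b : ℕ →₀ ℕ) :
    {α ∈ compatibleSeqs ρ | ∑ j, Finsupp.single (α j) 1 = b}.ncard =
      {P | (cellWeight P = b ∧ ∀ p ∈ P, p.row ≤ p.letter) ∧ cellWord P = ρ}.ncard := by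
  refine Set.ncard_congr (fun α _ => (cellList ρ α).toFinset) ?_ ?_ ?_
  · rintro α ⟨hα, hb⟩
    have hp := pairwise_cellList hρ hα
    refine ⟨⟨?_, fun p hp => ?_⟩, ?_⟩
    · rw [cellWeight_toFinset hp, ← hb]
      simp [cellList, List.map_ofFn, List.sum_ofFn]
    · simp only [cellList, List.mem_toFinset, List.mem_ofFn] at hp
      obtain ⟨j, rfl⟩ := hp
      exact hα.2.2 j
    · rw [cellWord_toFinset hp, map_letter_cellList]
  · rintro α β ⟨hα, -⟩ ⟨hβ, -⟩ h
    have h1 := congrArg Finset.sort h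
    rw [sort_toFinset_of_pairwise_lt (pairwise_cellList hρ hα),
      sort_toFinset_of_pairwise_lt (pairwise_cellList hρ hβ)] at h1
    have h2 := List.ofFn_injective h1
    exact funext fun j => congrArg Cell.row (congrFun h2 j)
  · rintro P ⟨⟨rfl, hP⟩, rfl⟩
    have hlen : (cellWord P).length = P.sort.length := by simp [cellWord]
    have hlt' : ∀ j : Fin (cellWord P).length, (j : ℕ) < P.sort.length := fun j => by
      have := j.2
      omega
    let α : Fin (cellWord P).length → ℕ := fun j => (P.sort[(j : ℕ)]'(hlt' j)).row
    have hget : ∀ j : Fin (cellWord P).length,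
        (cellWord P).get j = (P.sort[(j : ℕ)]'(hlt' j)).letter := fun j =>
      List.getElem_map Cell.letter
    have hlist : cellList (cellWord P) α = P.sort := by
      refine List.ext_getElem (by simp [cellList, hlen]) fun i h1 h2 => ?_
      simp only [cellList, List.getElem_ofFn]
      rw [hget]
      rfl
    have hlt : ∀ i j : Fin (cellWord P).length, i < j →
        P.sort[(i : ℕ)]'(hlt' i) < P.sort[(j : ℕ)]'(hlt' j) := fun i j hij =>
      List.pairwise_iff_getElem.1 (pairwise_lt_sort P) i j _ _ hij
    have hα : α ∈ compatibleSeqs (cellWord P) := by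
      refine ⟨fun i j hij => ?_, fun i j hij h => ?_, fun j => ?_⟩
      · rcases hij.eq_or_lt with rfl | hij
        · exact le_rfl
        · exact Cell.row_le_row (hlt i j hij).le
      · have h1 := Cell.lt_iff.1 (hlt i j (by rw [Fin.lt_def]; omega))
        rw [hget, hget] at h
        change (P.sort[(i : ℕ)]'(hlt' i)).row < (P.sort[(j : ℕ)]'(hlt' j)).row
        omega
      · rw [hget]
        exact hP _ ((Finset.mem_sort _).1 (List.getElem_mem _))
    have hset : (cellList (cellWord P) α).toFinset = P := by
      rw [hlist, Finset.sort_toFinset]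
    refine ⟨α, ⟨hα, ?_⟩, hset⟩
    conv_rhs => rw [← hset, cellWeight_toFinset (pairwise_cellList hρ hα)]
    simp [cellList, List.map_ofFn, List.sum_ofFn]

theorem coeff_schubert (w : Equiv.Perm ℕ) (b : ℕ →₀ ℕ) :
    MvPolynomial.coeff b (schubert w) = ((boundedCells w b).ncard : ℤ) := by
  rw [schubert, finsum_mem_eq_finite_toFinset_sum _ (finite_reducedWords w),
    MvPolynomial.coeff_sum, ncard_eq_sum_ncard_fiber (finite_boundedCells w b) (f := cellWord)
      (t := (finite_reducedWords w).toFinset) fun P hP => by simpa using hP.1.1, Nat.cast_sum]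
  refine Finset.sum_congr rfl fun ρ hρ => ?_
  rw [Set.Finite.mem_toFinset] at hρ
  have hset : {P ∈ boundedCells w b | cellWord P = ρ} =
      {P | (cellWeight P = b ∧ ∀ p ∈ P, p.row ≤ p.letter) ∧ cellWord P = ρ} := by
    ext P
    constructor
    · rintro ⟨⟨⟨-, h1⟩, h2⟩, h3⟩
      exact ⟨⟨h1, h2⟩, h3⟩
    · rintro ⟨⟨h1, h2⟩, h3⟩
      exact ⟨⟨⟨by rwa [h3], h1⟩, h2⟩, h3⟩
  classical
  rw [hset, ← ncard_compatibleSeqs (isChain_ne_of_reduced (by rw [hρ.1, hρ.2])),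
    finsum_mem_eq_finite_toFinset_sum _ (finite_compatibleSeqs ρ), MvPolynomial.coeff_sum]
  have hcoeff : ∀ α : Fin ρ.length → ℕ,
      MvPolynomial.coeff b (∏ j, MvPolynomial.X (α j) : MvPolynomial ℕ ℤ) =
        if ∑ j, Finsupp.single (α j) 1 = b then 1 else 0 := fun α => by
    rw [← MvPolynomial.coeff_monomial, MvPolynomial.monomial_sum_one]
    rfl
  simp_rw [hcoeff]
  rw [Finset.sum_boole, ← Set.ncard_coe_finset]
  congr 2
  ext α
  simp

/-! ### The product -/

/-- The embedding of the cells which adds `n` to the letters. -/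
def shiftCell (n : ℕ) : Cell ↪ Cell where
  toFun p := Cell.mk p.row (n + p.letter)
  inj' p q h := by
    have h' : Cell.mk p.row (n + p.letter) = Cell.mk q.row (n + q.letter) := h
    have h1 := congrArg Cell.row h'
    have h2 := congrArg Cell.letter h'
    exact Cell.ext h1 (Nat.add_left_cancel h2)

@[simp] theorem row_shiftCell (n : ℕ) (p : Cell) : (shiftCell n p).row = p.row := rfl

@[simp] theorem letter_shiftCell (n : ℕ) (p : Cell) : (shiftCell n p).letter = n + p.letter := rfl

theorem strictMono_shiftCell (n : ℕ) : StrictMono (shiftCell n) := fun p q h => by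
  have := Cell.lt_iff.1 h
  rw [Cell.lt_iff, row_shiftCell, row_shiftCell, letter_shiftCell, letter_shiftCell]
  omega

theorem cellWord_map_shiftCell (n : ℕ) (Q : Finset Cell) :
    cellWord (Q.map (shiftCell n)) = (cellWord Q).map (n + ·) := by
  rw [cellWord, ← ((strictMono_shiftCell n).strictMonoOn _).map_finsetSort, cellWord,
    List.map_map, List.map_map]
  rfl

theorem cellWeight_map_shiftCell (n : ℕ) (Q : Finset Cell) :
    cellWeight (Q.map (shiftCell n)) = cellWeight Q := by
  simp [cellWeight]

theorem cellWord_filter (P : Finset Cell) (p : ℕ → Prop) [DecidablePred p] :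
    cellWord (P.filter fun x => p x.letter) = (cellWord P).filter p := by
  have h : (P.sort.filter fun x => p x.letter).Pairwise (· < ·) := (pairwise_lt_sort P).filter _
  have h1 : P.filter (fun x => p x.letter) = (P.sort.filter fun x => p x.letter).toFinset := by
    ext x
    simp
  rw [h1, cellWord_toFinset h, cellWord, List.filter_map]
  rfl

theorem filter_lt_union_map_shiftCell {n : ℕ} {P Q : Finset Cell} (hP : ∀ p ∈ P, p.letter < n) :
    (P ∪ Q.map (shiftCell n)).filter (fun x => x.letter < n) = P := by
  ext x
  simp only [Finset.mem_filter, Finset.mem_union, Finset.mem_map]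
  constructor
  · rintro ⟨h | ⟨y, -, rfl⟩, h1⟩
    · exact h
    · simp at h1
  · exact fun h => ⟨Or.inl h, hP x h⟩

theorem filter_le_union_map_shiftCell {n : ℕ} {P Q : Finset Cell} (hP : ∀ p ∈ P, p.letter < n) :
    (P ∪ Q.map (shiftCell n)).filter (fun x => n ≤ x.letter) = Q.map (shiftCell n) := by
  ext x
  simp only [Finset.mem_filter, Finset.mem_union]
  constructor
  · rintro ⟨h | h, h1⟩
    · have := hP x h
      omega
    · exact h
  · intro h
    refine ⟨Or.inr h, ?_⟩
    obtain ⟨y, -, rfl⟩ := Finset.mem_map.1 h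
    simp

theorem cellWeight_union_map_shiftCell {n : ℕ} {P Q : Finset Cell} (hP : ∀ p ∈ P, p.letter < n) :
    cellWeight (P ∪ Q.map (shiftCell n)) = cellWeight P + cellWeight Q := by
  rw [← cellWeight_map_shiftCell n Q, cellWeight, cellWeight, cellWeight, Finset.sum_union]
  rw [Finset.disjoint_left]
  intro x hx h
  obtain ⟨y, -, rfl⟩ := Finset.mem_map.1 h
  simpa using hP _ hx

theorem letter_lt_of_reduced {m : ℕ} {u : Equiv.Perm ℕ} (hu : ∀ i, m ≤ i → u i = i)
    {P : Finset Cell} (hP : cellWord P ∈ reducedWords u) : ∀ p ∈ P, p.letter + 1 < m := by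
  intro p hp
  by_contra hc
  have h : ∀ i, wordProd (cellWord P) i < p.letter + 1 ↔ i < p.letter + 1 := by
    rw [hP.1]
    exact apply_lt_iff fun i hi => hu i (by omega)
  exact add_one_ne_of_mem_reduced (by rw [hP.1, hP.2]) h _ (mem_cellWord.2 ⟨p, hp, rfl⟩) rfl

theorem exists_union_map_shiftCell (n : ℕ) (R : Finset Cell) :
    ∃ Q : Finset Cell, R = R.filter (fun x => x.letter < n) ∪ Q.map (shiftCell n) := by
  refine ⟨(R.filter fun x => n ≤ x.letter).image fun x => Cell.mk x.row (x.letter - n), ?_⟩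
  ext x
  simp only [Finset.mem_union, Finset.mem_filter, Finset.mem_map, Finset.mem_image]
  constructor
  · intro hx
    rcases lt_or_ge x.letter n with h | h
    · exact Or.inl ⟨hx, h⟩
    · refine Or.inr ⟨_, ⟨x, ⟨hx, h⟩, rfl⟩, ?_⟩
      exact Cell.ext rfl (by simp [h])
  · rintro (h | ⟨_, ⟨y, ⟨hy, h⟩, rfl⟩, rfl⟩)
    · exact h.1
    · convert hy
      exact Cell.ext rfl (by simp [h])

theorem ncard_boundedCells_cross {n : ℕ} {u v : Equiv.Perm ℕ} (hu : ∀ i, n ≤ i → u i = i)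
    {b : ℕ →₀ ℕ} (hb : ∀ i ∈ b.support, i < n) :
    (boundedCells (cross n u v hu) b).ncard =
      ∑ c ∈ Finset.HasAntidiagonal.antidiagonal b, (boundedCells u c.1).ncard * (reducedCells v c.2).ncard := by
  classical
  have hlt : ∀ {P : Finset Cell}, cellWord P ∈ reducedWords u → ∀ p ∈ P, p.letter < n :=
    fun hP p hp => by
      have := letter_lt_of_reduced hu hP p hp
      omega
  have hred : ∀ {P Q : Finset Cell}, (∀ p ∈ P, p.letter < n) →
      (cellWord (P ∪ Q.map (shiftCell n)) ∈ reducedWords (cross n u v hu) ↔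
        cellWord P ∈ reducedWords u ∧ cellWord Q ∈ reducedWords v) := fun hP => by
    refine mem_reducedWords_cross_iff hu ?_ ?_
    · rw [← cellWord_filter, filter_lt_union_map_shiftCell hP]
    · rw [← cellWord_filter, filter_le_union_map_shiftCell hP, cellWord_map_shiftCell]
  let T : Set (Finset Cell × Finset Cell) :=
    ⋃ c ∈ Finset.HasAntidiagonal.antidiagonal b, boundedCells u c.1 ×ˢ reducedCells v c.2
  have hT : ∀ {x}, x ∈ T ↔ (cellWord x.1 ∈ reducedWords u ∧ ∀ p ∈ x.1, p.row ≤ p.letter) ∧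
      cellWord x.2 ∈ reducedWords v ∧ cellWeight x.1 + cellWeight x.2 = b := fun {x} => by
    simp only [T, Set.mem_iUnion, Finset.HasAntidiagonal.mem_antidiagonal, Set.mem_prod, boundedCells,
      reducedCells, Set.mem_ofPred_eq]
    constructor
    · rintro ⟨c, rfl, ⟨⟨h1, h2⟩, h3⟩, h4, h5⟩
      exact ⟨⟨h1, h3⟩, h4, by rw [h2, h5]⟩
    · rintro ⟨⟨h1, h3⟩, h4, h5⟩
      exact ⟨(_, _), h5, ⟨⟨h1, rfl⟩, h3⟩, h4, rfl⟩
  have hTfin : T.Finite := (Finset.finite_toSet _).biUnion fun c _ =>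
    (finite_boundedCells u c.1).prod (finite_reducedCells v c.2)
  have hcard : T.ncard =
      ∑ c ∈ Finset.HasAntidiagonal.antidiagonal b, (boundedCells u c.1).ncard * (reducedCells v c.2).ncard := by
    rw [ncard_eq_sum_ncard_fiber hTfin (f := fun x => (cellWeight x.1, cellWeight x.2))
      (t := Finset.HasAntidiagonal.antidiagonal b) fun x hx => Finset.HasAntidiagonal.mem_antidiagonal.2 (hT.1 hx).2.2]
    refine Finset.sum_congr rfl fun c hc => ?_
    rw [← Set.ncard_prod]
    congr 1
    ext x
    simp only [Set.mem_ofPred_eq, hT, Set.mem_prod, boundedCells, reducedCells, Prod.ext_iff]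
    rw [Finset.HasAntidiagonal.mem_antidiagonal] at hc
    constructor
    · rintro ⟨⟨⟨h1, h2⟩, h3, -⟩, h4, h5⟩
      exact ⟨⟨⟨h1, h4⟩, h2⟩, h3, h5⟩
    · rintro ⟨⟨⟨h1, h4⟩, h2⟩, h3, h5⟩
      exact ⟨⟨⟨h1, h2⟩, h3, by rw [h4, h5, hc]⟩, h4, h5⟩
  rw [← hcard]
  symm
  refine Set.ncard_congr (fun x _ => x.1 ∪ x.2.map (shiftCell n)) ?_ ?_ ?_
  · intro x hx
    obtain ⟨⟨h1, h2⟩, h3, h4⟩ := hT.1 hx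
    refine ⟨⟨(hred (hlt h1)).2 ⟨h1, h3⟩, ?_⟩, fun p hp => ?_⟩
    · rw [cellWeight_union_map_shiftCell (hlt h1), h4]
    · rcases Finset.mem_union.1 hp with hp | hp
      · exact h2 p hp
      · obtain ⟨q, hq, rfl⟩ := Finset.mem_map.1 hp
        have : q.row < n := by
          refine hb _ (Finsupp.mem_support_iff.2 ?_)
          rw [← h4, Finsupp.add_apply, cellWeight_apply x.2]
          have := Finset.card_ne_zero_of_mem (Finset.mem_filter.2 ⟨hq, rfl⟩ :
            q ∈ x.2.filter (·.row = q.row))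
          omega
        simp only [row_shiftCell, letter_shiftCell]
        omega
  · intro x y hx hy h
    have h1 := hlt (hT.1 hx).1.1
    have h2 := hlt (hT.1 hy).1.1
    refine Prod.ext ?_ ?_
    · rw [← filter_lt_union_map_shiftCell (Q := x.2) h1,
        ← filter_lt_union_map_shiftCell (Q := y.2) h2]
      exact congrArg _ h
    · refine Finset.map_injective (shiftCell n) ?_
      rw [← filter_le_union_map_shiftCell (Q := x.2) h1,
        ← filter_le_union_map_shiftCell (Q := y.2) h2]
      exact congrArg _ h
  · rintro R ⟨⟨h1, h2⟩, h3⟩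
    obtain ⟨Q, hQ⟩ := exists_union_map_shiftCell n R
    have hlt' : ∀ p ∈ R.filter (fun x => x.letter < n), p.letter < n := fun p hp =>
      (Finset.mem_filter.1 hp).2
    refine ⟨(R.filter fun x => x.letter < n, Q), hT.2 ?_, hQ.symm⟩
    rw [hQ, hred hlt'] at h1
    rw [hQ, cellWeight_union_map_shiftCell hlt'] at h2
    exact ⟨⟨h1.1, fun p hp => h3 p (Finset.mem_filter.1 hp).1⟩, h1.2, h2⟩

theorem boundedCells_eq_empty {m : ℕ} {u : Equiv.Perm ℕ} (hu : ∀ i, m ≤ i → u i = i)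
    {b : ℕ →₀ ℕ} {i : ℕ} (hi : i ∈ b.support) (hmi : m ≤ i) : boundedCells u b = ∅ := by
  ext P
  simp only [Set.mem_empty_iff_false, iff_false]
  rintro ⟨⟨h1, rfl⟩, h2⟩
  rw [Finsupp.mem_support_iff, cellWeight_apply, Finset.card_ne_zero] at hi
  obtain ⟨p, hp⟩ := hi
  rw [Finset.mem_filter] at hp
  have := letter_lt_of_reduced hu h1 p hp.1
  have := h2 p hp.1
  omega

open Classical in
theorem coeff_truncateVars (k : ℕ) (f : MvPowerSeries ℕ ℤ) (b : ℕ →₀ ℕ) :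
    MvPowerSeries.coeff b (truncateVars k f) =
      if ∀ i ∈ b.support, i < k then MvPowerSeries.coeff b f else 0 :=
  rfl

end SchubertStanley

theorem mainTheorem1 (u v : Equiv.Perm ℕ) (hv : {i | v i ≠ i}.Finite)
    (m k n : ℕ) (hm : IsLeast {m | ∀ i, m ≤ i → u i = i} m) (hmk : m ≤ k) (hkn : k ≤ n) :
    SchubertStanley.truncateVars k
        (SchubertStanley.schubert
          (SchubertStanley.cross n u v fun i hi => hm.1 i ((hmk.trans hkn).trans hi)) :
          MvPowerSeries ℕ ℤ) =
      (SchubertStanley.schubert u : MvPowerSeries ℕ ℤ) *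
        SchubertStanley.truncateVars k (SchubertStanley.stanley v) := by
  ext b
  rw [MvPowerSeries.coeff_mul, SchubertStanley.coeff_truncateVars]
  simp only [MvPolynomial.coeff_coe, SchubertStanley.coeff_schubert, SchubertStanley.coeff_truncateVars, SchubertStanley.coeff_stanley]
  split_ifs with hb
  · rw [SchubertStanley.ncard_boundedCells_cross _ fun i hi => (hb i hi).trans_le hkn, Nat.cast_sum]
    refine Finset.sum_congr rfl fun c hc => ?_
    have hc' : ∀ i ∈ c.2.support, i < k := fun i hi => by
      refine hb i ?_
      rw [← Finset.HasAntidiagonal.mem_antidiagonal.1 hc]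
      rw [Finsupp.mem_support_iff] at hi ⊢
      rw [Finsupp.add_apply]
      omega
    rw [if_pos hc', Nat.cast_mul]
  · push Not at hb
    obtain ⟨i, hi, hki⟩ := hb
    refine (Finset.sum_eq_zero fun c hc => ?_).symm
    split_ifs with hc'
    · rw [SchubertStanley.boundedCells_eq_empty hm.1 (i := i) ?_ (hmk.trans hki), Set.ncard_empty, Nat.cast_zero,
        zero_mul]
      rw [← Finset.HasAntidiagonal.mem_antidiagonal.1 hc] at hi
      rw [Finsupp.mem_support_iff] at hi ⊢
      intro h0
      rw [Finsupp.add_apply, h0, zero_add] at hi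
      have := hc' i (Finsupp.mem_support_iff.2 hi)
      omega
    · rw [mul_zero]
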